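/- Let $D$ be any virtual link diagram with $\mu\ge 0$ components, i.e. $\mu$ oriented circles generically immersed in the plane (the only self-intersections are transverse double points), each double point being designated as virtual, or as classical with one of its two strands overpassing. Cutting the circles at the underpassing points of the classical crossings yields the set $A(D)$ of arcs; let $C(D)$ be the set of classical crossings. For $c\in C(D)$ let $a(c)$ be the overpassing arc at $c$, and let $b_1(c)$ and $b_2(c)$ be the underpassing arcs at $c$ on the right and on the left of $a(c)$, respectively. For $a\in A(D)$ let $\kappa(a)\in\{1,\dots,\mu\}$ be the index of the component containing $a$. Let $L$ be the link represented by $D$. The fundamental quandle $Q(L)$ is the quandle with generators $q_a$ $(a\in A(D))$ and relations $q_{b_1(c)}\triangleright q_{a(c)}=q_{b_2(c)}$ $(c\in C(D))$. The link group $G(L)$ is the group with generators $g_a$ $(a\in A(D))$ and relations $g_{a(c)}g_{b_1(c)}g_{a(c)}^{-1}g_{b_2(c)}^{-1}=1$ $(c\in C(D))$. For a group $G$, $\mathrm{Conj}(G)$ is the set $G$ with the quandle operation $x\triangleright y=yxy^{-1}$. The natural image of $Q(L)$ in $G(L)/G(L)''$ is the image of the quandle homomorphism $Q(L)\to\mathrm{Conj}(G(L)/G(L)'')$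 with $q_a\mapsto g_aG(L)''$ for all $a \in A(D)$, where $G(L)''$ is the second derived subgroup. Let $\Lambda_\mu=\mathbb Z[t_1^{\pm1},\dots,t_\mu^{\pm1}]$. The Alexander module $M_A(L)$ is the quotient of the free $\Lambda_\mu$-module on $A(D)$ by the submodule generated by the elements \[(1-t_{\kappa(b_1(c))})\,a(c)+t_{\kappa(a(c))}\,b_1(c)-b_2(c),\qquad c\in C(D);\] the image of $a\in A(D)$ in $M_A(L)$ is denoted $\gamma_D(a)$. Let $I_\mu$ be the ideal of $\Lambda_\mu$ generated by $t_1-1,\dots,t_\mu-1$, and let $\phi_L:M_A(L)\to I_\mu$ be the $\Lambda_\mu$-linear map with $\phi_L(\gamma_D(a))=t_{\kappa(a)}-1$ for all $a\in A(D)$. The total multivariate Alexander quandle is \[U(L)=\{x\in M_A(L)\mid \phi_L(x)+1\text{ is a unit of }\Lambda_\mu\},\qquad x\triangleright y=(\phi_L(y)+1)x-\phi_L(x)y,\] and the fundamental multivariate Alexander quandle $Q_A(L)$ is the subquandle of $U(L)$ generated by $\{\gamma_D(a)\mid a\in A(D)\}$. Theorem. The quandle $U(L)$ is isomorphic to $\mathrm{Conj}(G(L)/G(L)'')$.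 Moreover, there is a quandle isomorphism $U(L)\to\mathrm{Conj}(G(L)/G(L)'')$ that maps $Q_A(L)$ onto the natural image of $Q(L)$ in $G(L)/G(L)''$. -/

import Mathlib

open scoped Quandles Topology

noncomputable section

/-! ### Quandles: presentations and generated subquandles

The operation `x ▷ y` (with `y` acting on `x`) is written `y ◃ x` in Mathlib's left-handed
convention. In particular `x ▷ y = y * x * y⁻¹` in `Quandle.Conj G`. -/

/-- Formal words in the two quandle operations on a set `A` of generators. -/
inductive QuandleWord (A : Type*) where
  | of : A → QuandleWord A
  | act : QuandleWord A → QuandleWord A → QuandleWord A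
  | invAct : QuandleWord A → QuandleWord A → QuandleWord A

/-- The smallest congruence on quandle words that contains `rels` and forces the quandle axioms. -/
inductive QuandleCongr {A : Type*} (rels : QuandleWord A → QuandleWord A → Prop) :
    QuandleWord A → QuandleWord A → Prop where
  | rel {x y} : rels x y → QuandleCongr rels x y
  | refl (x) : QuandleCongr rels x x
  | symm {x y} : QuandleCongr rels x y → QuandleCongr rels y x
  | trans {x y z} : QuandleCongr rels x y → QuandleCongr rels y z → QuandleCongr rels x z
  | act {x x' y y'} : QuandleCongr rels x x' → QuandleCongr rels y y' →
      QuandleCongr rels (.act x y) (.act x' y')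
  | invAct {x x' y y'} : QuandleCongr rels x x' → QuandleCongr rels y y' →
      QuandleCongr rels (.invAct x y) (.invAct x' y')
  | self_distrib (x y z) :
      QuandleCongr rels (.act x (.act y z)) (.act (.act x y) (.act x z))
  | left_inv (x y) : QuandleCongr rels (.invAct x (.act x y)) y
  | right_inv (x y) : QuandleCongr rels (.act x (.invAct x y)) y
  | fix (x) : QuandleCongr rels (.act x x) x

/-- The congruence as a setoid. -/
def quandleSetoid {A : Type*} (rels : QuandleWord A → QuandleWord A → Prop) :
    Setoid (QuandleWord A) where
  r := QuandleCongr rels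
  iseqv := ⟨.refl, .symm, .trans⟩

/-- The quandle presented by the generators `A` and the relations `rels`. -/
def PresentedQuandle {A : Type*} (rels : QuandleWord A → QuandleWord A → Prop) :=
  Quotient (quandleSetoid rels)

namespace PresentedQuandle

variable {A : Type*} {rels : QuandleWord A → QuandleWord A → Prop}

/-- The element of the presented quandle represented by a generator. -/
def of (a : A) : PresentedQuandle rels := Quotient.mk (quandleSetoid rels) (.of a)

instance : Quandle (PresentedQuandle rels) where
  act := Quotient.map₂ QuandleWord.act fun _ _ h _ _ h' => QuandleCongr.act h h'
  self_distrib := by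
    rintro ⟨x⟩ ⟨y⟩ ⟨z⟩
    exact Quotient.sound (QuandleCongr.self_distrib x y z)
  invAct := Quotient.map₂ QuandleWord.invAct fun _ _ h _ _ h' => QuandleCongr.invAct h h'
  left_inv := by
    rintro ⟨x⟩ ⟨y⟩
    exact Quotient.sound (QuandleCongr.left_inv x y)
  right_inv := by
    rintro ⟨x⟩ ⟨y⟩
    exact Quotient.sound (QuandleCongr.right_inv x y)
  fix := by
    rintro ⟨x⟩
    exact Quotient.sound (QuandleCongr.fix x)

/-- The value of a quandle word under an assignment of its generators. -/
def eval {R : Type*} [Quandle R] (f : A → R) : QuandleWord A → R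
  | .of a => f a
  | .act x y => eval f x ◃ eval f y
  | .invAct x y => eval f x ◃⁻¹ eval f y

theorem eval_congr {R : Type*} [Quandle R] (f : A → R)
    (hf : ∀ x y, rels x y → eval f x = eval f y) {x y : QuandleWord A}
    (h : QuandleCongr rels x y) : eval f x = eval f y := by
  induction h with
  | rel h => exact hf _ _ h
  | refl => rfl
  | symm _ ih => exact ih.symm
  | trans _ _ ih ih' => exact ih.trans ih'
  | act _ _ ih ih' => simp only [eval, ih, ih']
  | invAct _ _ ih ih' => simp only [eval, ih, ih']
  | self_distrib => exact Shelf.self_distrib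
  | left_inv x y => exact Rack.left_inv _ _
  | right_inv x y => exact Rack.right_inv _ _
  | fix => exact Quandle.fix

/-- The homomorphism out of a presented quandle determined by the images of the generators. -/
def lift {R : Type*} [Quandle R] (f : A → R)
    (hf : ∀ x y, rels x y → eval f x = eval f y) : PresentedQuandle rels →◃ R where
  toFun := Quotient.lift (eval f) fun _ _ h => eval_congr f hf h
  map_act' := by
    rintro ⟨x⟩ ⟨y⟩
    rfl

end PresentedQuandle

/-- The subquandle generated by a subset `S` of a quandle. -/
inductive QuandleClosure {R : Type*} [Quandle R] (S : Set R) : R → Prop where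
  | mem {x} : x ∈ S → QuandleClosure S x
  | act {x y} : QuandleClosure S x → QuandleClosure S y → QuandleClosure S (x ◃ y)
  | invAct {x y} : QuandleClosure S x → QuandleClosure S y → QuandleClosure S (x ◃⁻¹ y)

/-! ### Virtual link diagrams -/

/-- The disjoint union of `μ` oriented circles. -/
abbrev Circles (μ : ℕ) := Fin μ × UnitAddCircle

/-- The determinant of two vectors of the oriented plane. It is positive exactly when `w` points
to the left of `v`. -/
def planeDet (v w : ℝ × ℝ) : ℝ := v.1 * w.2 - v.2 * w.1

/-- The velocity of a map from the circles to the plane, at a point of one of the circles. -/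
def velocity {μ : ℕ} (pos : Circles μ → ℝ × ℝ) (p : Circles μ) : ℝ × ℝ :=
  deriv (fun s : ℝ => pos (p.1, p.2 + (s : UnitAddCircle))) 0

/-- A virtual link diagram with `μ` components: `μ` oriented circles generically immersed in the
plane, some of whose double points are declared to be classical crossings. The double points that
are not declared to be classical are the virtual crossings. -/
structure VirtualLinkDiagram (μ : ℕ) where
  /-- the immersion -/
  pos : Circles μ → ℝ × ℝ
  contDiff : ∀ i, ContDiff ℝ 1 (fun s : ℝ => pos (i, (s : UnitAddCircle)))
  immersed : ∀ p, velocity pos p ≠ 0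
  transverse : ∀ p q, p ≠ q → pos p = pos q → planeDet (velocity pos p) (velocity pos q) ≠ 0
  no_triple : ∀ p q r, pos p = pos q → pos q = pos r → p = q ∨ q = r ∨ p = r
  /-- the classical crossings, each given as the pair of its overpassing and its underpassing
  point -/
  crossings : Finset (Circles μ × Circles μ)
  crossing_ne : ∀ c ∈ crossings, c.1 ≠ c.2
  crossing_pos : ∀ c ∈ crossings, pos c.1 = pos c.2
  /-- the two points over a classical crossing are not both overpassing -/
  crossing_asymm : ∀ c ∈ crossings, c.swap ∉ crossings

namespace VirtualLinkDiagram

variable {μ : ℕ} (D : VirtualLinkDiagram μ)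

/-- The set `C(D)` of classical crossings. -/
abbrev Crossing := {c : Circles μ × Circles μ // c ∈ D.crossings}

/-- The underpassing points, where the circles are cut. -/
def underPoints : Set (Circles μ) := Prod.snd '' (D.crossings : Set (Circles μ × Circles μ))

/-- The circles with the underpassing points removed. -/
abbrev Cut := {p : Circles μ // p ∉ D.underPoints}

/-- The set `A(D)` of arcs: the pieces into which the circles are cut. -/
abbrev Arc := ConnectedComponents D.Cut

theorem continuous_component : Continuous (fun p : D.Cut => p.1.1) :=
  continuous_fst.comp continuous_subtype_val

/-- `κ_D(a)`, the index of the component to which an arc belongs. -/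
def component : D.Arc → Fin μ := D.continuous_component.connectedComponentsLift

theorem over_not_mem_underPoints (c : D.Crossing) : c.1.1 ∉ D.underPoints := by
  obtain ⟨⟨p, q⟩, hc⟩ := c
  rintro ⟨⟨r, p'⟩, hc', h⟩
  have hc' : (r, p') ∈ D.crossings := hc'
  obtain rfl : p' = p := h
  have h1 := D.crossing_ne _ hc
  have h2 := D.crossing_ne _ hc'
  have h3 := D.crossing_asymm _ hc
  rcases D.no_triple r p' q (D.crossing_pos _ hc') (D.crossing_pos _ hc) with h | h | h
  · exact h2 h
  · exact h1 h
  · subst h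
    exact h3 hc'

/-- `a(c)`, the overpassing arc at a crossing. -/
def overArc (c : D.Crossing) : D.Arc :=
  ConnectedComponents.mk ⟨c.1.1, D.over_not_mem_underPoints c⟩

/-- The points `p + s` of the circles lie on the arc `a`, for all `s` near `0` in the filter `l`. -/
def GermOn (l : Filter ℝ) (p : Circles μ) (a : D.Arc) : Prop :=
  ∀ᶠ s : ℝ in l, ∃ h : (p.1, p.2 + (s : UnitAddCircle)) ∉ D.underPoints,
    (ConnectedComponents.mk ⟨_, h⟩ : D.Arc) = a

theorem exists_radius (p : Circles μ) : ∃ ε : ℝ, 0 < ε ∧ ∀ s : ℝ, s ≠ 0 → |s| < ε →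
    (p.1, p.2 + (s : UnitAddCircle)) ∉ D.underPoints := by
  have hfin : (D.underPoints \ {p}).Finite := (D.crossings.finite_toSet.image _).subset
    Set.sdiff_subset
  have hc : Continuous (fun s : ℝ => ((p.1, p.2 + (s : UnitAddCircle)) : Circles μ)) :=
    continuous_const.prodMk (continuous_const.add (AddCircle.continuous_mk' 1))
  have hopen := hfin.isClosed.isOpen_compl.preimage hc
  obtain ⟨ε, hε, hball⟩ := Metric.isOpen_iff.1 hopen 0 (by simp)
  refine ⟨min ε 1, lt_min hε one_pos, fun s hs0 hs hmem => ?_⟩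
  have h1 := hball (show s ∈ Metric.ball (0 : ℝ) ε by
    simpa using hs.trans_le (min_le_left _ _))
  refine h1 ⟨hmem, fun heq => hs0 ?_⟩
  have h2 : p.2 + (s : UnitAddCircle) = p.2 := congrArg Prod.snd heq
  have h3 : (s : UnitAddCircle) = 0 := by simpa using h2
  obtain ⟨n, hn⟩ := (AddCircle.coe_eq_zero_iff (1 : ℝ)).1 h3
  have h4 : |s| < 1 := hs.trans_le (min_le_right _ _)
  have h5 : (n : ℝ) = s := by simpa using hn
  rw [← h5] at h4
  have h6 : |n| < 1 := by exact_mod_cast h4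
  rw [← h5, Int.abs_lt_one_iff.1 h6, Int.cast_zero]

theorem exists_arc_of_Ioo (p : Circles μ) {u v : ℝ} (huv : u < v)
    (h : ∀ s ∈ Set.Ioo u v, (p.1, p.2 + (s : UnitAddCircle)) ∉ D.underPoints) :
    ∃ a : D.Arc, ∀ s (hs : s ∈ Set.Ioo u v), ConnectedComponents.mk ⟨_, h s hs⟩ = a := by
  have hc : Continuous (fun s : ℝ => ((p.1, p.2 + (s : UnitAddCircle)) : Circles μ)) :=
    continuous_const.prodMk (continuous_const.add (AddCircle.continuous_mk' 1))
  let g : Set.Ioo u v → D.Arc := fun s => ConnectedComponents.mk ⟨_, h s.1 s.2⟩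
  have hg : Continuous g := ConnectedComponents.continuous_coe.comp
    ((hc.comp continuous_subtype_val).subtype_mk _)
  have : PreconnectedSpace (Set.Ioo u v) := Subtype.preconnectedSpace isPreconnected_Ioo
  obtain ⟨m, hm⟩ := exists_between huv
  exact ⟨g ⟨m, hm⟩, fun s hs => (isPreconnected_univ.image g hg.continuousOn).subsingleton
    (Set.mem_image_of_mem g (Set.mem_univ ⟨s, hs⟩))
    (Set.mem_image_of_mem g (Set.mem_univ ⟨m, hm⟩))⟩

theorem exists_arcBefore (p : Circles μ) : ∃ a, D.GermOn (𝓝[<] 0) p a := by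
  obtain ⟨ε, hε, h⟩ := D.exists_radius p
  have h' : ∀ s ∈ Set.Ioo (-ε) 0, (p.1, p.2 + (s : UnitAddCircle)) ∉ D.underPoints :=
    fun s hs => h s hs.2.ne (abs_lt.2 ⟨hs.1, hs.2.trans hε⟩)
  obtain ⟨a, ha⟩ := D.exists_arc_of_Ioo p (neg_lt_zero.2 hε) h'
  exact ⟨a, Filter.mem_of_superset (Ioo_mem_nhdsLT (neg_lt_zero.2 hε))
    fun s hs => ⟨h' s hs, ha s hs⟩⟩

theorem exists_arcAfter (p : Circles μ) : ∃ a, D.GermOn (𝓝[>] 0) p a := by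
  obtain ⟨ε, hε, h⟩ := D.exists_radius p
  have h' : ∀ s ∈ Set.Ioo 0 ε, (p.1, p.2 + (s : UnitAddCircle)) ∉ D.underPoints :=
    fun s hs => h s hs.1.ne' (abs_lt.2 ⟨(neg_lt_zero.2 hε).trans hs.1, hs.2⟩)
  obtain ⟨a, ha⟩ := D.exists_arc_of_Ioo p hε h'
  exact ⟨a, Filter.mem_of_superset (Ioo_mem_nhdsGT hε) fun s hs => ⟨h' s hs, ha s hs⟩⟩

/-- The arc that runs into the point `p`, with respect to the orientation. -/
def arcBefore (p : Circles μ) : D.Arc := (D.exists_arcBefore p).choose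

/-- The arc that leaves the point `p`, with respect to the orientation. -/
def arcAfter (p : Circles μ) : D.Arc := (D.exists_arcAfter p).choose

theorem component_of_germ {l : Filter ℝ} [l.NeBot] {p : Circles μ} {a : D.Arc}
    (h : D.GermOn l p a) : D.component a = p.1 := by
  obtain ⟨s, hs, rfl⟩ := h.exists
  rfl

theorem component_arcBefore (p : Circles μ) : D.component (D.arcBefore p) = p.1 :=
  D.component_of_germ (D.exists_arcBefore p).choose_spec

theorem component_arcAfter (p : Circles μ) : D.component (D.arcAfter p) = p.1 :=
  D.component_of_germ (D.exists_arcAfter p).choose_spec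

/-- The underpassing strand crosses the overpassing one from its right to its left. -/
def RightToLeft (c : D.Crossing) : Prop :=
  0 < planeDet (velocity D.pos c.1.1) (velocity D.pos c.1.2)

open Classical in
/-- `b₁(c)`, the underpassing arc on the right of the overpassing arc. -/
def rightArc (c : D.Crossing) : D.Arc :=
  if D.RightToLeft c then D.arcBefore c.1.2 else D.arcAfter c.1.2

open Classical in
/-- `b₂(c)`, the underpassing arc on the left of the overpassing arc. -/
def leftArc (c : D.Crossing) : D.Arc :=
  if D.RightToLeft c then D.arcAfter c.1.2 else D.arcBefore c.1.2

theorem component_rightArc (c : D.Crossing) :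
    D.component (D.rightArc c) = D.component (D.leftArc c) := by
  unfold rightArc leftArc
  split_ifs <;> rw [component_arcBefore, component_arcAfter]

/-! ### The link group and the fundamental quandle -/

/-- The relators `g_{a(c)} g_{b₁(c)} g_{a(c)}⁻¹ g_{b₂(c)}⁻¹`. -/
def groupRels : Set (FreeGroup D.Arc) :=
  Set.range fun c : D.Crossing => FreeGroup.of (D.overArc c) * FreeGroup.of (D.rightArc c) *
    (FreeGroup.of (D.overArc c))⁻¹ * (FreeGroup.of (D.leftArc c))⁻¹

/-- The group `G(L)`. -/
abbrev LinkGroup := PresentedGroup D.groupRels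

/-- The relations `q_{b₁(c)} ▷ q_{a(c)} = q_{b₂(c)}`. -/
inductive QuandleRel : QuandleWord D.Arc → QuandleWord D.Arc → Prop where
  | crossing (c : D.Crossing) :
      QuandleRel (.act (.of (D.overArc c)) (.of (D.rightArc c))) (.of (D.leftArc c))

/-- The fundamental quandle `Q(L)`. -/
abbrev FundamentalQuandle := PresentedQuandle D.QuandleRel

theorem group_relation (c : D.Crossing) :
    (PresentedGroup.of (D.overArc c) * PresentedGroup.of (D.rightArc c) *
      (PresentedGroup.of (D.overArc c))⁻¹ : D.LinkGroup) = PresentedGroup.of (D.leftArc c) := by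
  rw [← mul_inv_eq_one]
  exact PresentedGroup.one_of_mem ⟨c, rfl⟩

/-- The natural map `Q(L) → Conj G(L)`, `q_a ↦ g_a`. -/
def toConjGroup : D.FundamentalQuandle →◃ Quandle.Conj D.LinkGroup :=
  PresentedQuandle.lift (R := Quandle.Conj D.LinkGroup) (fun a => PresentedGroup.of a) (by
    rintro _ _ ⟨c⟩
    exact D.group_relation c)

/-- The metabelian quotient `G(L)/G(L)''`. -/
abbrev MetabelianQuotient := D.LinkGroup ⧸ derivedSeries D.LinkGroup 2

/-- The natural map `Q(L) → Conj (G(L)/G(L)'')`. -/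
def toConjMetabelian : D.FundamentalQuandle →◃ Quandle.Conj D.MetabelianQuotient :=
  (Quandle.Conj.map (QuotientGroup.mk' (derivedSeries D.LinkGroup 2))).comp D.toConjGroup

/-- The natural image of `Q(L)` in `G(L)/G(L)''`. -/
def naturalImage : Set (Quandle.Conj D.MetabelianQuotient) := Set.range D.toConjMetabelian

end VirtualLinkDiagram

/-! ### The Alexander module and its quandles -/

/-- The ring `Λ_μ` of integral Laurent polynomials in `μ` variables. -/
abbrev LaurentRing (μ : ℕ) := AddMonoidAlgebra ℤ (Fin μ →₀ ℤ)

/-- The variable `t_i`. -/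
def LaurentRing.t {μ : ℕ} (i : Fin μ) : LaurentRing μ :=
  AddMonoidAlgebra.single (Finsupp.single i 1) 1

/-- The augmentation ideal `I_μ`, generated by the elements `t_i - 1`. -/
def augmentationIdeal (μ : ℕ) : Ideal (LaurentRing μ) :=
  Ideal.span (Set.range fun i : Fin μ => LaurentRing.t i - 1)

namespace VirtualLinkDiagram

open LaurentRing

variable {μ : ℕ} (D : VirtualLinkDiagram μ)

/-- The map `ρ_D` from the free module on the crossings to the free module on the arcs. -/
def rho : (D.Crossing →₀ LaurentRing μ) →ₗ[LaurentRing μ] (D.Arc →₀ LaurentRing μ) :=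
  Finsupp.linearCombination (LaurentRing μ) fun c =>
    Finsupp.single (D.overArc c) (1 - t (D.component (D.rightArc c))) +
      Finsupp.single (D.rightArc c) (t (D.component (D.overArc c))) -
      Finsupp.single (D.leftArc c) 1

/-- The multivariate Alexander module `M_A(L)`, the cokernel of `ρ_D`. -/
abbrev AlexanderModule := (D.Arc →₀ LaurentRing μ) ⧸ LinearMap.range D.rho

/-- The element `γ_D(a)` of the Alexander module. -/
def gamma (a : D.Arc) : D.AlexanderModule :=
  Submodule.Quotient.mk (Finsupp.single a 1)

/-- The map `a ↦ t_{κ(a)} - 1` on the free module on the arcs. -/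
def crowellAux : (D.Arc →₀ LaurentRing μ) →ₗ[LaurentRing μ] augmentationIdeal μ :=
  Finsupp.linearCombination (LaurentRing μ) fun a =>
    (⟨t (D.component a) - 1, Ideal.subset_span ⟨_, rfl⟩⟩ : augmentationIdeal μ)

theorem crowellAux_rho : LinearMap.range D.rho ≤ LinearMap.ker D.crowellAux := by
  rw [LinearMap.range_le_ker_iff]
  ext c
  simp only [rho, crowellAux, LinearMap.comp_apply, Finsupp.lsingle_apply,
    Finsupp.linearCombination_single, one_smul, map_sub, map_add, LinearMap.zero_apply,
    Submodule.coe_sub, Submodule.coe_add, Submodule.coe_smul, smul_eq_mul, ZeroMemClass.coe_zero,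
    D.component_rightArc c]
  ring_nf

/-- The Crowell map `φ_L : M_A(L) → I_μ`, `γ_D(a) ↦ t_{κ(a)} - 1`. -/
def crowell : D.AlexanderModule →ₗ[LaurentRing μ] augmentationIdeal μ :=
  (LinearMap.range D.rho).liftQ D.crowellAux D.crowellAux_rho

/-- The Crowell map followed by the inclusion of `I_μ` in `Λ_μ`. -/
def phi : D.AlexanderModule →ₗ[LaurentRing μ] LaurentRing μ :=
  (augmentationIdeal μ).subtype ∘ₗ D.crowell

theorem phi_gamma (a : D.Arc) : D.phi (D.gamma a) = t (D.component a) - 1 := by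
  simp [phi, gamma, crowell, crowellAux]

/-- The set `U(L)` of all `x ∈ M_A(L)` such that `φ_L(x) + 1` is a unit of `Λ_μ`. -/
def TotalQuandle := {x : D.AlexanderModule // IsUnit (D.phi x + 1)}

theorem phi_act (x y : D.AlexanderModule) :
    D.phi ((D.phi y + 1) • x - D.phi x • y) = D.phi x := by
  simp only [map_sub, map_smul, smul_eq_mul]
  ring

theorem phi_invAct (x : D.AlexanderModule) (y : D.TotalQuandle) :
    D.phi ((↑y.2.unit⁻¹ : LaurentRing μ) • (x + D.phi x • y.1)) = D.phi x := by
  have h : (↑y.2.unit⁻¹ : LaurentRing μ) * (D.phi y.1 + 1) = 1 := y.2.val_inv_mul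
  simp only [map_add, map_smul, smul_eq_mul]
  linear_combination D.phi x * h

/-- The total multivariate Alexander quandle, with `x ▷ y = (φ(y) + 1) x - φ(x) y`. -/
instance : Quandle D.TotalQuandle where
  act y x := ⟨(D.phi y.1 + 1) • x.1 - D.phi x.1 • y.1, by rw [phi_act]; exact x.2⟩
  self_distrib := by
    intro x y z
    apply Subtype.ext
    simp only [phi_act]
    module
  invAct y x := ⟨(↑y.2.unit⁻¹ : LaurentRing μ) • (x.1 + D.phi x.1 • y.1), by
    rw [phi_invAct]; exact x.2⟩
  left_inv := by
    intro y x
    apply Subtype.ext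
    have h : (↑y.2.unit⁻¹ : LaurentRing μ) * (D.phi y.1 + 1) = 1 := y.2.val_inv_mul
    simp only [phi_act, sub_add_cancel, smul_smul, h, one_smul]
  right_inv := by
    intro y x
    apply Subtype.ext
    have h : (D.phi y.1 + 1) * (↑y.2.unit⁻¹ : LaurentRing μ) = 1 := y.2.mul_val_inv
    simp only [phi_invAct, smul_smul, h, one_smul, add_sub_cancel_right]
  fix := by
    intro x
    apply Subtype.ext
    simp only
    module

theorem isUnit_t (i : Fin μ) : IsUnit (t i : LaurentRing μ) := by
  refine IsUnit.of_mul_eq_one (AddMonoidAlgebra.single (-Finsupp.single i 1) 1) ?_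
  rw [t, AddMonoidAlgebra.single_mul_single, add_neg_cancel, one_mul]
  rfl

/-- `γ_D(a)` as an element of `U(L)`. -/
def gammaU (a : D.Arc) : D.TotalQuandle :=
  ⟨D.gamma a, by rw [phi_gamma, sub_add_cancel]; exact isUnit_t _⟩

/-- The fundamental multivariate Alexander quandle `Q_A(L)`, the subquandle of `U(L)` generated by
the elements `γ_D(a)`. -/
def fundamentalAlexanderQuandle : Set D.TotalQuandle :=
  {x | QuandleClosure (Set.range D.gammaU) x}

end VirtualLinkDiagram

end

/-!
By Crowell's theorem the Alexander module, with the map `d` that sends `g_a` to `γ_D(a)`, is the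
universal crossed homomorphism of `G(L)` over its abelianization `ψ : G(L) → ℤ^μ`. The group of
affine maps `m ↦ x + (φ(x) + 1) m` has `U(L)` as its underlying set and the operation of `U(L)` as
its conjugation, and `d` is a homomorphism into it. For every surjection `ψ : G → X` with kernel
`K`, the universal `d` has kernel `[K, K]`, because the Schreier cocycle with values in the
`ℤ[X]`-module coinduced from the abelianization of `K` factors through it. The elements killed by
`φ` are the values of `d` on `K`, `φ` takes values in the augmentation ideal, and the units of
augmentation `1` of `ℤ[ℤ^μ]` are the monomials, so `d` is onto the affine group. For links, `K` is
the commutator subgroup of `G(L)`, since the arcs of one component have conjugate generators.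
-/

open scoped AddMonoidAlgebra

noncomputable section

/-! ### Subquandles generated by the image of a presentation -/

section QuandleHom

theorem rackHom_map_invAct {R S : Type*} [Rack R] [Rack S] (f : R →◃ S) (x y : R) :
    f (x ◃⁻¹ y) = f x ◃⁻¹ f y := by
  rw [← Rack.left_cancel (f x), ← ShelfHom.map_act, Rack.act_invAct_eq, Rack.act_invAct_eq]

variable {A R S : Type*} [Quandle R] [Quandle S]

theorem QuandleClosure.image (e : R →◃ S) (s : Set R) :
    e '' {x | QuandleClosure s x} = {y | QuandleClosure (e '' s) y} := by
  apply Set.Subset.antisymm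
  · rintro _ ⟨x, hx, rfl⟩
    induction hx with
    | mem hx => exact .mem (Set.mem_image_of_mem e hx)
    | act _ _ hx hy => exact (e.map_act).symm ▸ .act hx hy
    | invAct _ _ hx hy => exact (rackHom_map_invAct e _ _).symm ▸ .invAct hx hy
  · intro y hy
    induction hy with
    | mem hy => exact Set.image_mono (fun _ => .mem) hy
    | act _ _ ihx ihy =>
      obtain ⟨x, hx, rfl⟩ := ihx
      obtain ⟨y, hy, rfl⟩ := ihy
      exact ⟨x ◃ y, .act hx hy, e.map_act⟩
    | invAct _ _ ihx ihy =>
      obtain ⟨x, hx, rfl⟩ := ihx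
      obtain ⟨y, hy, rfl⟩ := ihy
      exact ⟨x ◃⁻¹ y, .invAct hx hy, rackHom_map_invAct e x y⟩

theorem PresentedQuandle.closure_range_of (rels : QuandleWord A → QuandleWord A → Prop) :
    {x | QuandleClosure (Set.range (of : A → PresentedQuandle rels)) x} = Set.univ := by
  refine Set.eq_univ_of_forall ?_
  rintro ⟨w⟩
  induction w with
  | of a => exact .mem ⟨a, rfl⟩
  | act _ _ hx hy => exact .act hx hy
  | invAct _ _ hx hy => exact .invAct hx hy

theorem PresentedQuandle.range_eq_closure {rels : QuandleWord A → QuandleWord A → Prop}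
    (f : PresentedQuandle rels →◃ S) :
    Set.range f = {y | QuandleClosure (Set.range fun a => f (of a)) y} := by
  rw [← Set.image_univ, ← closure_range_of, QuandleClosure.image, ← Set.range_comp]
  rfl

end QuandleHom

/-! ### Group rings -/

section GroupRing

theorem exists_eq_single_of_mul_eq_single {R X : Type*} [Semiring R] [NoZeroDivisors R] [Add X]
    [TwoUniqueSums X] {f g : R[X]} {c : X} {r : R} (hr : r ≠ 0)
    (hfg : f * g = .single c r) : ∃ h s, f = .single h s := by
  have sum_eq_of_uniqueAdd : ∀ p ∈ f.coeff.support ×ˢ g.coeff.support,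
      UniqueAdd f.coeff.support g.coeff.support p.1 p.2 → p.1 + p.2 = c := by
    intro p hp hunique
    by_contra hne
    have hcoeff := AddMonoidAlgebra.coeff_mul_add_of_uniqueAdd hunique
    rw [hfg, AddMonoidAlgebra.coeff_single, Finsupp.single_eq_of_ne hne] at hcoeff
    rw [Finset.mem_product, Finsupp.mem_support_iff, Finsupp.mem_support_iff] at hp
    exact mul_ne_zero hp.1 hp.2 hcoeff.symm
  have hcard_mul : f.coeff.support.card * g.coeff.support.card ≤ 1 := by
    by_contra! hlt
    obtain ⟨p, hp, q, hq, hpq, hup, huq⟩ := TwoUniqueSums.uniqueAdd_of_one_lt_card hlt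
    have hsum := (sum_eq_of_uniqueAdd p hp hup).trans (sum_eq_of_uniqueAdd q hq huq).symm
    rw [Finset.mem_product] at hp
    obtain ⟨hfst, hsnd⟩ := huq hp.1 hp.2 hsum
    exact hpq (Prod.ext hfst hsnd)
  have hg : 0 < g.coeff.support.card := by
    rw [Finset.card_pos, Finsupp.support_nonempty_iff, ne_eq, AddMonoidAlgebra.coeff_eq_zero]
    rintro rfl
    simp [eq_comm, hr] at hfg
  have : Nonempty X := ⟨c⟩
  obtain ⟨h, s, hf⟩ :=
    Finsupp.card_support_le_one'.1 ((Nat.le_mul_of_pos_right _ hg).trans hcard_mul)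
  exact ⟨h, s, AddMonoidAlgebra.coeff_injective hf⟩

/-- The augmentation of a monoid algebra: the sum of the coefficients. -/
def augmentation (R X : Type*) [CommSemiring R] [AddMonoid X] : R[X] →ₐ[R] R :=
  AddMonoidAlgebra.lift R R X 1

theorem augmentation_single {R X : Type*} [CommSemiring R] [AddMonoid X] (h : X) (r : R) :
    augmentation R X (.single h r) = r := by
  simp [augmentation]

theorem exists_eq_single_one_of_isUnit {R X : Type*} [CommSemiring R] [NoZeroDivisors R]
    [Nontrivial R] [AddMonoid X] [TwoUniqueSums X] {f : R[X]} (hf : IsUnit f)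
    (haug : augmentation R X f = 1) : ∃ h, f = .single h 1 := by
  obtain ⟨g, hfg, -⟩ := isUnit_iff_exists.1 hf
  obtain ⟨h, r, rfl⟩ := exists_eq_single_of_mul_eq_single one_ne_zero hfg
  rw [augmentation_single] at haug
  exact ⟨h, by rw [haug]⟩

/-- The additive map on an integral monoid algebra determined by its values on the monomials. -/
def monomialLift {X N : Type*} [AddCommGroup N] (w : X → N) : ℤ[X] →+ N :=
  (Finsupp.liftAddHom fun h => zmultiplesHom N (w h)).comp
    AddMonoidAlgebra.coeffAddEquiv.toAddMonoidHom

theorem monomialLift_single_one {X N : Type*} [AddCommGroup N] (w : X → N) (h : X) :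
    monomialLift w (.single h 1) = w h := by
  simp [monomialLift]

/-- The homomorphism into the group ring of `X` given by a homomorphism into `X`. -/
def monomialHom {G X : Type*} [Group G] [AddGroup X] (ψ : G →* Multiplicative X) : G →* ℤ[X] :=
  (AddMonoidAlgebra.of ℤ X).comp ψ

theorem monomialHom_apply {G X : Type*} [Group G] [AddGroup X] (ψ : G →* Multiplicative X)
    (g : G) : monomialHom ψ g = .single (ψ g).toAdd 1 :=
  rfl

theorem ker_monomialHom {G X : Type*} [Group G] [AddGroup X] (ψ : G →* Multiplicative X) :
    (monomialHom ψ).ker = ψ.ker :=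
  MonoidHom.ker_comp_of_injective _ _ AddMonoidAlgebra.of_injective

/-- The `ℤ[X]`-module coinduced from the additive group `B`: the functions from `X` to `B`, on
which the monomial of `k` acts by `f ↦ f (· + k)`. -/
def Coinduced (X B : Type*) := X → B

namespace Coinduced

variable {X B : Type*} [AddMonoid X] [AddCommGroup B]

instance : AddCommGroup (Coinduced X B) := inferInstanceAs (AddCommGroup (X → B))

/-- The action of the monomials on the coinduced module. -/
def translate : Multiplicative X →* Module.End ℤ (Coinduced X B) where
  toFun k := LinearMap.funLeft ℤ B (· + k.toAdd)
  map_one' := by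
    ext f h
    exact congrArg f (add_zero h)
  map_mul' k l := by
    ext f h
    exact congrArg f (add_assoc h k.toAdd l.toAdd).symm

instance : Module ℤ[X] (Coinduced X B) :=
  Module.compHom _ (AddMonoidAlgebra.lift ℤ (Module.End ℤ (Coinduced X B)) X translate).toRingHom

theorem single_one_smul_apply (k : X) (f : Coinduced X B) (h : X) :
    (AddMonoidAlgebra.single k (1 : ℤ) • f) h = f (h + k) := by
  change (AddMonoidAlgebra.lift ℤ _ X translate (.single k 1) : Module.End ℤ _) f h = _
  rw [AddMonoidAlgebra.lift_single, one_smul]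
  rfl

end Coinduced

end GroupRing

/-! ### The affine group of a linear form -/

/-- The group of affine maps `m ↦ x + (φ x + 1) • m` of a module that are determined by their
translation part `x` through a linear form `φ`. -/
@[ext]
structure AffineGroup {R M : Type*} [Ring R] [AddCommGroup M] [Module R M] (φ : M →ₗ[R] R) where
  translation : M
  isUnit : IsUnit (φ translation + 1)

namespace AffineGroup

variable {R M : Type*} [Ring R] [AddCommGroup M] [Module R M] {φ : M →ₗ[R] R}

theorem map_add_smul_add_one (x y : M) :
    φ (x + (φ x + 1) • y) + 1 = (φ x + 1) * (φ y + 1) := by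
  rw [map_add, map_smul, smul_eq_mul]
  noncomm_ring

theorem map_neg_inv_smul_add_one {x : M} {u : Rˣ} (hu : φ x + 1 = u) :
    φ (-((↑u⁻¹ : R) • x)) + 1 = ↑u⁻¹ := by
  rw [map_neg, map_smul, smul_eq_mul, eq_sub_of_add_eq hu, mul_sub, u.inv_mul, mul_one]
  abel

instance : Mul (AffineGroup φ) where
  mul x y := ⟨x.translation + (φ x.translation + 1) • y.translation, by
    rw [map_add_smul_add_one]; exact x.isUnit.mul y.isUnit⟩

instance : One (AffineGroup φ) where
  one := ⟨0, by rw [map_zero, zero_add]; exact isUnit_one⟩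

instance : Inv (AffineGroup φ) where
  inv x := ⟨-((↑x.isUnit.unit⁻¹ : R) • x.translation), by
    rw [map_neg_inv_smul_add_one x.isUnit.unit_spec.symm]; exact Units.isUnit _⟩

theorem translation_mul (x y : AffineGroup φ) :
    (x * y).translation = x.translation + (φ x.translation + 1) • y.translation :=
  rfl

theorem translation_one : (1 : AffineGroup φ).translation = 0 := rfl

theorem translation_inv (x : AffineGroup φ) :
    (x⁻¹).translation = -((↑x.isUnit.unit⁻¹ : R) • x.translation) :=
  rfl

instance : Group (AffineGroup φ) :=
  Group.ofLeftAxioms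
    (fun x y z => AffineGroup.ext <| by
      simp only [translation_mul, map_add_smul_add_one, smul_add, mul_smul, add_assoc])
    (fun x => AffineGroup.ext <| by
      rw [translation_mul, translation_one, map_zero, zero_add, zero_add, one_smul])
    (fun x => AffineGroup.ext <| by
      rw [translation_mul, translation_inv, map_neg_inv_smul_add_one x.isUnit.unit_spec.symm,
        neg_add_cancel, translation_one])

/-- The linear part `φ x + 1` of an affine map. -/
def linearPart : AffineGroup φ →* R where
  toFun x := φ x.translation + 1
  map_one' := by rw [translation_one, map_zero, zero_add]
  map_mul' x y := map_add_smul_add_one x.translation y.translation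

theorem linearPart_apply (x : AffineGroup φ) : linearPart x = φ x.translation + 1 := rfl

theorem mem_ker_linearPart {x : AffineGroup φ} : x ∈ linearPart.ker ↔ φ x.translation = 0 := by
  rw [MonoidHom.mem_ker, linearPart_apply, add_eq_right]

theorem mul_comm_of_mem_ker_linearPart {x y : AffineGroup φ} (hx : x ∈ linearPart.ker)
    (hy : y ∈ linearPart.ker) : x * y = y * x := by
  rw [mem_ker_linearPart] at hx hy
  apply AffineGroup.ext
  rw [translation_mul, translation_mul, hx, hy, zero_add, one_smul, one_smul, add_comm]

end AffineGroup

/-! ### Crossed homomorphisms -/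

/-- A crossed homomorphism (derivation) of a group into a module on which the group acts through
`χ`. -/
def IsCrossedHom {G R M : Type*} [Group G] [Ring R] [AddCommGroup M] [Module R M] (χ : G →* R)
    (d : G → M) : Prop :=
  ∀ g g', d (g * g') = d g + χ g • d g'

namespace IsCrossedHom

variable {G R M N : Type*} [Group G] [Ring R] [AddCommGroup M] [Module R M] [AddCommGroup N]
  [Module R N] {χ : G →* R} {d d' : G → M}

protected theorem map_one (hd : IsCrossedHom χ d) : d 1 = 0 := by
  have h := hd 1 1
  rwa [mul_one, χ.map_one, one_smul, left_eq_add] at h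

protected theorem map_inv (hd : IsCrossedHom χ d) (g : G) : d g⁻¹ = -(χ g⁻¹ • d g) := by
  have h := hd g⁻¹ g
  rw [inv_mul_cancel, hd.map_one] at h
  exact eq_neg_of_add_eq_zero_left h.symm

theorem linearMap_comp (hd : IsCrossedHom χ d) (L : M →ₗ[R] N) :
    IsCrossedHom χ (L ∘ d) := fun g g' => by
  simp only [Function.comp_apply, hd g g', map_add, map_smul]

theorem eq_of_eqOn_dense (hd : IsCrossedHom χ d) (hd' : IsCrossedHom χ d') {s : Set G}
    (hs : Subgroup.closure s = ⊤) (h : s.EqOn d d') : d = d' := by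
  funext g
  have hg : g ∈ Subgroup.closure s := hs ▸ Subgroup.mem_top g
  induction hg using Subgroup.closure_induction with
  | mem g hg => exact h hg
  | one => rw [hd.map_one, hd'.map_one]
  | mul g g' _ _ ih ih' => rw [hd, hd', ih, ih']
  | inv g _ ih => rw [hd.map_inv, hd'.map_inv, ih]

/-- The restriction of a crossed homomorphism to the elements that act trivially, where it is
additive. -/
def kerHom (hd : IsCrossedHom χ d) : Additive χ.ker →+ M where
  toFun g := d g.toMul
  map_zero' := hd.map_one
  map_add' g g' := by
    rw [toMul_add, Subgroup.coe_mul, hd, MonoidHom.mem_ker.1 g.toMul.2, one_smul]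

theorem sub_mem_range_kerHom (hd : IsCrossedHom χ d) {g g' : G} (h : χ g = χ g') :
    d g - d g' ∈ hd.kerHom.range := by
  have hker : g * g'⁻¹ ∈ χ.ker := by
    rw [MonoidHom.mem_ker, map_mul, h, ← map_mul, mul_inv_cancel, χ.map_one]
  refine ⟨.ofMul ⟨g * g'⁻¹, hker⟩, eq_sub_of_add_eq ?_⟩
  calc d (g * g'⁻¹) + d g' = d (g * g'⁻¹) + χ (g * g'⁻¹) • d g' := by
        rw [MonoidHom.mem_ker.1 hker, one_smul]
    _ = d g := by rw [← hd, inv_mul_cancel_right]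

end IsCrossedHom

theorem AffineGroup.isCrossedHom_translation {G R M : Type*} [Group G] [Ring R] [AddCommGroup M]
    [Module R M] {φ : M →ₗ[R] R} (F : G →* AffineGroup φ) :
    IsCrossedHom (linearPart.comp F) fun g => (F g).translation := fun g g' =>
  (congrArg translation (map_mul F g g')).trans (translation_mul _ _)

universe u v w

/-- The universal crossed homomorphism of a group over `χ`, whose target is the derived module of
`χ`. Uniqueness of the factorizations is expressed by the values spanning the target. The targets
of the crossed homomorphisms that factor are confined to the universe `w`. -/
structure IsUniversalCrossedHom {G R M : Type*} [Group G] [Ring R] [AddCommGroup M] [Module R M]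
    (χ : G →* R) (d : G → M) : Prop where
  isCrossedHom : IsCrossedHom χ d
  span_range : Submodule.span R (Set.range d) = ⊤
  exists_lift : ∀ {N : Type w} [AddCommGroup N] [Module R N] {δ : G → N}, IsCrossedHom χ δ →
    ∃ L : M →ₗ[R] N, ∀ g, L (d g) = δ g

/-! ### The derived module of a surjection onto a group -/

section CrowellSequence

variable {G : Type u} {X : Type v} {M : Type*} [Group G] [AddGroup X] [AddCommGroup M]
  [Module ℤ[X] M] {ψ : G →* Multiplicative X} {d : G → M}

theorem IsCrossedHom.closure_range_eq_top (hd : IsCrossedHom (monomialHom ψ) d)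
    (hψ : Function.Surjective ψ) (hspan : Submodule.span ℤ[X] (Set.range d) = ⊤) :
    AddSubgroup.closure (Set.range d) = ⊤ := by
  have single_smul_mem : ∀ k, ∀ m ∈ AddSubgroup.closure (Set.range d),
      (.single k 1 : ℤ[X]) • m ∈ AddSubgroup.closure (Set.range d) := by
    intro k m hm
    obtain ⟨s, hs⟩ := hψ (.ofAdd k)
    induction hm using AddSubgroup.closure_induction with
    | mem m hm =>
      obtain ⟨g, rfl⟩ := hm
      have h : (.single k 1 : ℤ[X]) • d g = d (s * g) - d s := by
        rw [hd, monomialHom_apply, hs, toAdd_ofAdd, add_sub_cancel_left]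
      rw [h]
      exact sub_mem (AddSubgroup.subset_closure ⟨_, rfl⟩) (AddSubgroup.subset_closure ⟨_, rfl⟩)
    | zero => rw [smul_zero]; exact zero_mem _
    | add m m' _ _ ih ih' => rw [smul_add]; exact add_mem ih ih'
    | neg m _ ih => rw [smul_neg]; exact neg_mem ih
  refine (AddSubgroup.eq_top_iff' _).2 fun m => ?_
  have hm : m ∈ Submodule.span ℤ[X] (Set.range d) := hspan ▸ Submodule.mem_top
  induction hm using Submodule.span_induction with
  | mem m hm => exact AddSubgroup.subset_closure hm
  | zero => exact zero_mem _
  | add m m' _ _ ih ih' => exact add_mem ih ih'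
  | smul r m _ ih =>
    induction r using AddMonoidAlgebra.induction_linear with
    | zero => rw [zero_smul]; exact zero_mem _
    | add r r' ihr ihr' => rw [add_smul]; exact add_mem ihr ihr'
    | single k n =>
      have h : (.single k n : ℤ[X]) • m = n • (.single k 1 : ℤ[X]) • m := by
        rw [← smul_assoc, AddMonoidAlgebra.smul_single, smul_eq_mul, mul_one]
      rw [h]
      exact zsmul_mem (single_smul_mem k m ih) n

variable {φ : M →ₗ[ℤ[X]] ℤ[X]}

theorem IsCrossedHom.augmentation_map_eq_zero (hd : IsCrossedHom (monomialHom ψ) d)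
    (hψ : Function.Surjective ψ) (hspan : Submodule.span ℤ[X] (Set.range d) = ⊤)
    (hφ : ∀ g, φ (d g) + 1 = monomialHom ψ g) (m : M) : augmentation ℤ X (φ m) = 0 := by
  suffices h : (augmentation ℤ X).toAddMonoidHom.comp φ.toAddMonoidHom = 0 from
    DFunLike.congr_fun h m
  refine AddMonoidHom.eq_of_eqOn_dense (hd.closure_range_eq_top hψ hspan) ?_
  rintro _ ⟨g, rfl⟩
  change augmentation ℤ X (φ (d g)) = 0
  rw [eq_sub_of_add_eq (hφ g), map_sub, map_one, monomialHom_apply,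
    augmentation_single, sub_self]

-- The class of `d g` modulo the values of `d` on the kernel depends only on `ψ g`, which defines a
-- map on `ℤ[X]` that recovers the class of `m` from `φ m`.
theorem IsCrossedHom.mem_range_kerHom_of_map_eq_zero (hd : IsCrossedHom (monomialHom ψ) d)
    (hψ : Function.Surjective ψ) (hspan : Submodule.span ℤ[X] (Set.range d) = ⊤)
    (hφ : ∀ g, φ (d g) + 1 = monomialHom ψ g) {m : M} (hm : φ m = 0) : m ∈ hd.kerHom.range := by
  let s : X → G := fun h => Function.surjInv hψ (.ofAdd h)
  have mk_section (g : G) : (d (s (ψ g).toAdd) : M ⧸ hd.kerHom.range) = d g := by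
    refine (QuotientAddGroup.eq_iff_sub_mem).2 (hd.sub_mem_range_kerHom ?_)
    rw [monomialHom_apply, monomialHom_apply, Function.surjInv_eq hψ, ofAdd_toAdd]
  let classOf : ℤ[X] →+ M ⧸ hd.kerHom.range := monomialLift fun h => d (s h)
  have classOf_monomial (g : G) : classOf (monomialHom ψ g) = d g :=
    (monomialLift_single_one _ _).trans (mk_section g)
  have classOf_map : classOf.comp φ.toAddMonoidHom = QuotientAddGroup.mk' hd.kerHom.range := by
    refine AddMonoidHom.eq_of_eqOn_dense (hd.closure_range_eq_top hψ hspan) ?_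
    rintro _ ⟨g, rfl⟩
    change classOf (φ (d g)) = d g
    rw [eq_sub_of_add_eq (hφ g), ← (monomialHom ψ).map_one, map_sub, classOf_monomial,
      classOf_monomial, hd.map_one, QuotientAddGroup.mk_zero, sub_zero]
  rw [← QuotientAddGroup.eq_zero_iff, ← QuotientAddGroup.mk'_apply, ← classOf_map]
  exact (congrArg classOf hm).trans classOf.map_zero

theorem schreier_mem_ker (hψ : Function.Surjective ψ) (h : X) (g : G) :
    Function.surjInv hψ (.ofAdd h) * g * (Function.surjInv hψ (.ofAdd (h + (ψ g).toAdd)))⁻¹ ∈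
      ψ.ker := by
  rw [MonoidHom.mem_ker, map_mul, map_mul, map_inv, Function.surjInv_eq hψ, Function.surjInv_eq hψ,
    ofAdd_add, ofAdd_toAdd, mul_inv_cancel]

/-- The Schreier cocycle `g ↦ (h ↦ s(h) g s(h + ψ g)⁻¹)` of a section `s` of `ψ`, with values in
the module coinduced from the abelianization of the kernel. -/
def schreierCocycle (hψ : Function.Surjective ψ) (g : G) :
    Coinduced X (Additive (Abelianization ψ.ker)) :=
  fun h => .ofMul (.of ⟨_, schreier_mem_ker hψ h g⟩)

theorem isCrossedHom_schreierCocycle (hψ : Function.Surjective ψ) :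
    IsCrossedHom (monomialHom ψ) (schreierCocycle hψ) := fun g g' => by
  funext h
  change _ = schreierCocycle hψ g h + (AddMonoidAlgebra.single (ψ g).toAdd (1 : ℤ) •
    schreierCocycle hψ g') h
  rw [Coinduced.single_one_smul_apply, schreierCocycle, schreierCocycle, schreierCocycle,
    ← ofMul_mul, ← map_mul]
  congr 2
  apply Subtype.ext
  simp only [Subgroup.coe_mul, map_mul, toAdd_mul, add_assoc]
  group

theorem mem_commutator_ker_of_schreierCocycle_eq_zero (hψ : Function.Surjective ψ) {g : G}
    (hg : ψ g = 1) (hσ : schreierCocycle hψ g = 0) : g ∈ ⁅ψ.ker, ψ.ker⁆ := by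
  let s : G := Function.surjInv hψ 1
  have hmem : (⟨_, schreier_mem_ker hψ 0 g⟩ : ψ.ker) ∈ commutator ψ.ker := by
    rw [← Abelianization.ker_of]
    exact congrArg Additive.toMul (congrFun hσ 0)
  have hconj : s * g * s⁻¹ ∈ ⁅ψ.ker, ψ.ker⁆ := by
    rw [← Subgroup.map_subtype_commutator]
    simpa [hg] using Subgroup.mem_map_of_mem ψ.ker.subtype hmem
  have : (⁅ψ.ker, ψ.ker⁆ : Subgroup G).Normal := inferInstance
  simpa [mul_assoc] using this.conj_mem _ hconj s⁻¹

theorem IsUniversalCrossedHom.ker_eq_commutator_ker {φ : M →ₗ[ℤ[X]] ℤ[X]} {F : G →* AffineGroup φ}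
    (huniv : IsUniversalCrossedHom.{max u v} (monomialHom ψ) fun g => (F g).translation)
    (hF : AffineGroup.linearPart.comp F = monomialHom ψ) (hψ : Function.Surjective ψ) :
    F.ker = ⁅ψ.ker, ψ.ker⁆ := by
  have mem_ker_linearPart {g : G} : F g ∈ AffineGroup.linearPart.ker ↔ g ∈ ψ.ker := by
    rw [← ker_monomialHom, ← hF, MonoidHom.mem_ker, MonoidHom.mem_ker, MonoidHom.comp_apply]
  apply le_antisymm
  · intro g hg
    have hψg : ψ g = 1 := mem_ker_linearPart.1 (by rw [hg]; exact one_mem _)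
    obtain ⟨L, hL⟩ := huniv.exists_lift (isCrossedHom_schreierCocycle hψ)
    refine mem_commutator_ker_of_schreierCocycle_eq_zero hψ hψg ?_
    rw [← hL, MonoidHom.mem_ker.1 hg, AffineGroup.translation_one, map_zero]
  · refine Subgroup.commutator_le.2 fun g hg g' hg' => ?_
    rw [MonoidHom.mem_ker, map_commutatorElement, commutatorElement_eq_one_iff_mul_comm]
    exact AffineGroup.mul_comm_of_mem_ker_linearPart (mem_ker_linearPart.2 hg)
      (mem_ker_linearPart.2 hg')

theorem IsCrossedHom.surjective_of_span_range [TwoUniqueSums X] {φ : M →ₗ[ℤ[X]] ℤ[X]}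
    {F : G →* AffineGroup φ} (hd : IsCrossedHom (monomialHom ψ) fun g => (F g).translation)
    (hspan : Submodule.span ℤ[X] (Set.range fun g => (F g).translation) = ⊤)
    (hF : AffineGroup.linearPart.comp F = monomialHom ψ) (hψ : Function.Surjective ψ) :
    Function.Surjective F := by
  intro x
  have hφ (g : G) : φ (F g).translation + 1 = monomialHom ψ g := DFunLike.congr_fun hF g
  have haug : augmentation ℤ X (φ x.translation + 1) = 1 := by
    rw [map_add, hd.augmentation_map_eq_zero hψ hspan hφ, zero_add, map_one]
  obtain ⟨h, hh⟩ := exists_eq_single_one_of_isUnit x.isUnit haug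
  obtain ⟨s, hs⟩ := hψ (.ofAdd h)
  have hker : x * (F s)⁻¹ ∈ AffineGroup.linearPart.ker := by
    have hlinear : AffineGroup.linearPart x = AffineGroup.linearPart (F s) := by
      rw [AffineGroup.linearPart_apply, AffineGroup.linearPart_apply, hφ, hh, monomialHom_apply,
        hs, toAdd_ofAdd]
    rw [MonoidHom.mem_ker, map_mul, hlinear, ← map_mul, mul_inv_cancel,
      map_one]
  obtain ⟨g, hg⟩ := hd.mem_range_kerHom_of_map_eq_zero hψ hspan hφ
    (AffineGroup.mem_ker_linearPart.1 hker)
  refine ⟨g.toMul * s, ?_⟩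
  rw [map_mul, ← eq_mul_inv_iff_mul_eq]
  exact AffineGroup.ext hg

end CrowellSequence

/-! ### Groups with free abelianization -/

section FreeAbelianization

variable {A ι G : Type*} [Group G] {g : A → G} {κ : A → ι} {ψ : G →* Multiplicative (ι →₀ ℤ)}

theorem surjective_of_map_eq_single (hκ : Function.Surjective κ)
    (hψ : ∀ a, ψ (g a) = .ofAdd (Finsupp.single (κ a) 1)) : Function.Surjective ψ := by
  rw [← MonoidHom.range_eq_top, Subgroup.eq_top_iff']
  intro h
  obtain ⟨h, rfl⟩ := Multiplicative.ofAdd.surjective h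
  induction h using Finsupp.induction_linear with
  | zero => exact one_mem _
  | add x y hx hy => exact mul_mem hx hy
  | single i n =>
    obtain ⟨a, rfl⟩ := hκ i
    refine ⟨g a ^ n, ?_⟩
    rw [map_zpow, hψ, ← ofAdd_zsmul, Finsupp.smul_single, smul_eq_mul, mul_one]

theorem ker_eq_commutator_of_map_eq_single (hg : Subgroup.closure (Set.range g) = ⊤)
    (hψ : ∀ a, ψ (g a) = .ofAdd (Finsupp.single (κ a) 1))
    (hκ : (fun a => Abelianization.of (g a)).FactorsThrough κ) : ψ.ker = commutator G := by
  refine le_antisymm ?_ (Abelianization.commutator_subset_ker ψ)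
  let classOf : ι → Abelianization G := Function.extend κ (fun a => Abelianization.of (g a)) 1
  let j : Multiplicative (ι →₀ ℤ) →* Abelianization G := AddMonoidHom.toMultiplicativeLeft
    (Finsupp.liftAddHom fun i => zmultiplesHom _ (.ofMul (classOf i)))
  have of_eq_comp : Abelianization.of = j.comp ψ := by
    refine MonoidHom.eq_of_eqOn_dense hg ?_
    rintro _ ⟨a, rfl⟩
    have hclass : classOf (κ a) = Abelianization.of (g a) := hκ.extend_apply 1 a
    simp [j, hψ, hclass]
  rw [← Abelianization.ker_of, of_eq_comp]
  exact fun x hx => (congrArg j hx).trans j.map_one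

end FreeAbelianization

namespace VirtualLinkDiagram

variable {μ : ℕ} (D : VirtualLinkDiagram μ)

/-! ### The arcs of a component -/

section Arcs

variable {D}

theorem component_surjective : Function.Surjective D.component := fun i =>
  ⟨D.arcAfter (i, 0), D.component_arcAfter _⟩

theorem GermOn.unique {l : Filter ℝ} [l.NeBot] {p : Circles μ} {a b : D.Arc}
    (ha : D.GermOn l p a) (hb : D.GermOn l p b) : a = b := by
  obtain ⟨s, ⟨_, hsa⟩, ⟨_, hsb⟩⟩ := (ha.and hb).exists
  exact hsa.symm.trans hsb

theorem germOn_arcBefore (p : Circles μ) : D.GermOn (𝓝[<] 0) p (D.arcBefore p) :=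
  (D.exists_arcBefore p).choose_spec

theorem germOn_arcAfter (p : Circles μ) : D.GermOn (𝓝[>] 0) p (D.arcAfter p) :=
  (D.exists_arcAfter p).choose_spec

theorem germOn_nhds_zero {p : Circles μ} (hp : p ∉ D.underPoints) :
    D.GermOn (𝓝 0) p (ConnectedComponents.mk ⟨p, hp⟩) := by
  obtain ⟨ε, hε, hcut⟩ := D.exists_radius p
  have hcut' : ∀ s ∈ Set.Ioo (-ε) ε, (p.1, p.2 + (s : UnitAddCircle)) ∉ D.underPoints := by
    intro s hs
    rcases eq_or_ne s 0 with rfl | hs0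
    · simpa using hp
    · exact hcut s hs0 (abs_lt.2 hs)
  obtain ⟨a, ha⟩ := D.exists_arc_of_Ioo p (neg_lt_self hε) hcut'
  have hmk : ConnectedComponents.mk ⟨p, hp⟩ = a := by
    rw [← ha 0 ⟨neg_lt_zero.2 hε, hε⟩]
    simp
  filter_upwards [Ioo_mem_nhds (neg_lt_zero.2 hε) hε] with s hs
  exact ⟨hcut' s hs, (ha s hs).trans hmk.symm⟩

theorem arcBefore_eq_mk {p : Circles μ} (hp : p ∉ D.underPoints) :
    D.arcBefore p = ConnectedComponents.mk ⟨p, hp⟩ :=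
  (germOn_arcBefore p).unique (nhdsWithin_le_nhds (germOn_nhds_zero hp))

theorem arcAfter_eq_mk {p : Circles μ} (hp : p ∉ D.underPoints) :
    D.arcAfter p = ConnectedComponents.mk ⟨p, hp⟩ :=
  (germOn_arcAfter p).unique (nhdsWithin_le_nhds (germOn_nhds_zero hp))

variable {T : Type*} {f : D.Arc → T} (hf : ∀ c, f (D.rightArc c) = f (D.leftArc c))

include hf

theorem apply_arcBefore_eq_apply_arcAfter (p : Circles μ) :
    f (D.arcBefore p) = f (D.arcAfter p) := by
  by_cases hp : p ∈ D.underPoints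
  · obtain ⟨c, hc, rfl⟩ := hp
    have hright := hf ⟨c, hc⟩
    unfold rightArc leftArc at hright
    split_ifs at hright
    exacts [hright, hright.symm]
  · rw [arcBefore_eq_mk hp, arcAfter_eq_mk hp]

theorem eventually_apply_arcBefore_eq (p : Circles μ) :
    ∀ᶠ s : ℝ in 𝓝 0, f (D.arcBefore (p.1, p.2 + (s : UnitAddCircle))) = f (D.arcBefore p) := by
  rw [← nhdsNE_sup_pure, ← nhdsLT_sup_nhdsGT, Filter.eventually_sup, Filter.eventually_sup,
    Filter.eventually_pure]
  refine ⟨⟨?_, ?_⟩, by rw [QuotientAddGroup.mk_zero, add_zero]⟩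
  · filter_upwards [germOn_arcBefore p] with s hs
    obtain ⟨hs, hmk⟩ := hs
    rw [arcBefore_eq_mk hs, hmk]
  · filter_upwards [germOn_arcAfter p] with s hs
    obtain ⟨hs, hmk⟩ := hs
    rw [arcBefore_eq_mk hs, hmk, apply_arcBefore_eq_apply_arcAfter hf]

theorem isLocallyConstant_apply_arcBefore (i : Fin μ) :
    IsLocallyConstant fun x : ℝ => f (D.arcBefore (i, (x : UnitAddCircle))) := by
  rw [IsLocallyConstant.iff_eventually_eq]
  intro x
  have hsub : Filter.Tendsto (· - x) (𝓝 x) (𝓝 0) :=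
    Continuous.tendsto' (by fun_prop) _ _ (sub_self x)
  filter_upwards [hsub.eventually (eventually_apply_arcBefore_eq hf (i, (x : UnitAddCircle)))]
    with y hy
  rwa [← QuotientAddGroup.mk_add, add_sub_cancel] at hy

theorem factorsThrough_component : f.FactorsThrough D.component := by
  intro a b hab
  obtain ⟨⟨⟨i, x⟩, hp⟩, rfl⟩ := ConnectedComponents.surjective_coe a
  obtain ⟨⟨⟨j, y⟩, hq⟩, rfl⟩ := ConnectedComponents.surjective_coe b
  obtain rfl : i = j := hab
  obtain ⟨x, rfl⟩ := QuotientAddGroup.mk_surjective x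
  obtain ⟨y, rfl⟩ := QuotientAddGroup.mk_surjective y
  rw [← arcBefore_eq_mk hp, ← arcBefore_eq_mk hq]
  exact (isLocallyConstant_apply_arcBefore hf i).apply_eq_of_preconnectedSpace x y

end Arcs

/-! ### The abelianization of the link group -/

open LaurentRing

theorem lift_groupRels {G : Type*} [Group G] {f : D.Arc → G}
    (hf : ∀ c, f (D.overArc c) * f (D.rightArc c) = f (D.leftArc c) * f (D.overArc c)) :
    ∀ r ∈ D.groupRels, FreeGroup.lift f r = 1 := by
  rintro _ ⟨c, rfl⟩
  simp only [map_mul, map_inv, FreeGroup.lift_apply_of, hf c, mul_inv_cancel_right,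
    mul_inv_cancel]

/-- The homomorphism `G(L) → ℤ^μ` that sends `g_a` to the basis vector of index `κ(a)`. -/
def degree : D.LinkGroup →* Multiplicative (Fin μ →₀ ℤ) :=
  PresentedGroup.toGroup (f := fun a => .ofAdd (Finsupp.single (D.component a) 1))
    (D.lift_groupRels fun c => by rw [D.component_rightArc c, mul_comm])

theorem degree_of (a : D.Arc) :
    D.degree (PresentedGroup.of a) = .ofAdd (Finsupp.single (D.component a) 1) :=
  PresentedGroup.toGroup.of _

theorem degree_surjective : Function.Surjective D.degree :=
  surjective_of_map_eq_single component_surjective D.degree_of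

theorem ker_degree : D.degree.ker = commutator D.LinkGroup := by
  refine ker_eq_commutator_of_map_eq_single (PresentedGroup.closure_range_of D.groupRels)
    D.degree_of (factorsThrough_component fun c => ?_)
  rw [← D.group_relation c, map_mul, map_mul, map_inv, mul_right_comm, mul_inv_cancel, one_mul]

theorem monomialHom_degree_of (a : D.Arc) :
    monomialHom D.degree (PresentedGroup.of a) = t (D.component a) := by
  rw [monomialHom_apply, degree_of]
  rfl

/-! ### The Alexander module as the derived module of the link group -/

theorem span_range_gamma : Submodule.span (LaurentRing μ) (Set.range D.gamma) = ⊤ := by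
  have hgamma : D.gamma = (LinearMap.range D.rho).mkQ ∘ Finsupp.basisSingleOne := by
    rw [Finsupp.coe_basisSingleOne]
    rfl
  rw [hgamma, Set.range_comp, Submodule.span_image, Module.Basis.span_eq, Submodule.map_top,
    Submodule.range_mkQ]

theorem gamma_relation (c : D.Crossing) :
    (1 - t (D.component (D.rightArc c))) • D.gamma (D.overArc c) +
      t (D.component (D.overArc c)) • D.gamma (D.rightArc c) = D.gamma (D.leftArc c) := by
  rw [← sub_eq_zero]
  simp only [gamma, ← Submodule.Quotient.mk_smul, ← Submodule.Quotient.mk_add,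
    ← Submodule.Quotient.mk_sub]
  rw [Submodule.Quotient.mk_eq_zero]
  exact ⟨Finsupp.single c 1, by simp [rho]⟩

/-- `U(L)` as the underlying set of the affine group of the Crowell map. -/
def totalQuandleEquiv : D.TotalQuandle ≃ AffineGroup D.phi where
  toFun x := ⟨x.1, x.2⟩
  invFun x := ⟨x.translation, x.isUnit⟩

theorem totalQuandleEquiv_act (x y : D.TotalQuandle) :
    D.totalQuandleEquiv (x ◃ y) =
      D.totalQuandleEquiv x * D.totalQuandleEquiv y * (D.totalQuandleEquiv x)⁻¹ := by
  refine eq_mul_inv_of_mul_eq (AffineGroup.ext ?_)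
  rw [AffineGroup.translation_mul, AffineGroup.translation_mul]
  change (D.phi x.1 + 1) • y.1 - D.phi y.1 • x.1 +
    (D.phi ((D.phi x.1 + 1) • y.1 - D.phi y.1 • x.1) + 1) • x.1 = x.1 + (D.phi x.1 + 1) • y.1
  rw [phi_act]
  module

/-- The homomorphism from `G(L)` to the affine group of the Crowell map that sends `g_a` to the
affine map with translation part `γ_D(a)`, as in Fox calculus. -/
def fox : D.LinkGroup →* AffineGroup D.phi :=
  PresentedGroup.toGroup (f := fun a => D.totalQuandleEquiv (D.gammaU a))
    (D.lift_groupRels fun c => AffineGroup.ext <| by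
      change D.gamma _ + (D.phi (D.gamma _) + 1) • D.gamma _ =
        D.gamma _ + (D.phi (D.gamma _) + 1) • D.gamma _
      rw [phi_gamma, phi_gamma, ← D.gamma_relation c, D.component_rightArc c]
      module)

theorem fox_of (a : D.Arc) : D.fox (PresentedGroup.of a) = D.totalQuandleEquiv (D.gammaU a) :=
  PresentedGroup.toGroup.of _

theorem translation_fox_of (a : D.Arc) :
    (D.fox (PresentedGroup.of a)).translation = D.gamma a := by
  rw [fox_of]
  rfl

theorem linearPart_comp_fox : AffineGroup.linearPart.comp D.fox = monomialHom D.degree := by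
  refine MonoidHom.eq_of_eqOn_dense (PresentedGroup.closure_range_of D.groupRels) ?_
  rintro _ ⟨a, rfl⟩
  rw [MonoidHom.comp_apply, AffineGroup.linearPart_apply, translation_fox_of, phi_gamma,
    sub_add_cancel, monomialHom_degree_of]

theorem isCrossedHom_fox :
    IsCrossedHom (monomialHom D.degree) fun g => (D.fox g).translation :=
  D.linearPart_comp_fox ▸ AffineGroup.isCrossedHom_translation D.fox

theorem linearCombination_comp_rho_eq_zero {N : Type*} [AddCommGroup N]
    [Module (LaurentRing μ) N] {δ : D.LinkGroup → N}
    (hδ : IsCrossedHom (monomialHom D.degree) δ) :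
    Finsupp.linearCombination (LaurentRing μ) (fun a => δ (PresentedGroup.of a)) ∘ₗ D.rho = 0 := by
  refine Finsupp.lhom_ext' fun c => LinearMap.ext_ring ?_
  have hright := hδ (PresentedGroup.of (D.overArc c)) (PresentedGroup.of (D.rightArc c))
  have hleft := hδ (PresentedGroup.of (D.leftArc c)) (PresentedGroup.of (D.overArc c))
  rw [← D.group_relation c, inv_mul_cancel_right, D.group_relation c, hright,
    monomialHom_degree_of, monomialHom_degree_of, ← D.component_rightArc c] at hleft
  simp only [rho, LinearMap.comp_apply, Finsupp.lsingle_apply, Finsupp.linearCombination_single,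
    one_smul, map_sub, map_add, LinearMap.zero_apply, sub_smul]
  rw [sub_add_eq_add_sub, hleft, add_sub_cancel_right, sub_self]

theorem isUniversalCrossedHom_fox :
    IsUniversalCrossedHom.{w} (monomialHom D.degree) fun g => (D.fox g).translation where
  isCrossedHom := D.isCrossedHom_fox
  span_range := by
    rw [eq_top_iff, ← D.span_range_gamma]
    refine Submodule.span_mono ?_
    rintro _ ⟨a, rfl⟩
    exact ⟨_, D.translation_fox_of a⟩
  exists_lift {N _ _ δ} hδ := by
    let L : D.AlexanderModule →ₗ[LaurentRing μ] N := (LinearMap.range D.rho).liftQ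
      (Finsupp.linearCombination (LaurentRing μ) fun a => δ (PresentedGroup.of a))
      (LinearMap.range_le_ker_iff.2 (D.linearCombination_comp_rho_eq_zero hδ))
    have hL (a : D.Arc) : L (D.gamma a) = δ (PresentedGroup.of a) := by simp [L, gamma]
    refine ⟨L, congrFun ((D.isCrossedHom_fox.linearMap_comp L).eq_of_eqOn_dense hδ
      (PresentedGroup.closure_range_of D.groupRels) ?_)⟩
    rintro _ ⟨a, rfl⟩
    rw [Function.comp_apply, translation_fox_of, hL]

theorem ker_fox : D.fox.ker = derivedSeries D.LinkGroup 2 := by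
  rw [D.isUniversalCrossedHom_fox.ker_eq_commutator_ker D.linearPart_comp_fox D.degree_surjective,
    ker_degree]
  rfl

theorem fox_surjective : Function.Surjective D.fox :=
  D.isCrossedHom_fox.surjective_of_span_range
    D.isUniversalCrossedHom_fox.{0}.span_range D.linearPart_comp_fox D.degree_surjective

/-- The isomorphism from `G(L)/G(L)''` to the affine group of the Crowell map. -/
def metabelianQuotientEquiv : D.MetabelianQuotient ≃* AffineGroup D.phi :=
  QuotientGroup.liftEquiv _ D.fox_surjective D.ker_fox.symm

/-- The isomorphism from `U(L)` to `Conj (G(L)/G(L)'')`. -/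
def totalQuandleHom : D.TotalQuandle →◃ Quandle.Conj D.MetabelianQuotient where
  toFun x := D.metabelianQuotientEquiv.symm (D.totalQuandleEquiv x)
  map_act' {x y} := by
    rw [totalQuandleEquiv_act, map_mul, map_mul, map_inv, Quandle.conj_act_eq_conj]

theorem totalQuandleHom_bijective : Function.Bijective D.totalQuandleHom :=
  (D.totalQuandleEquiv.trans D.metabelianQuotientEquiv.symm.toEquiv).bijective

theorem totalQuandleHom_gammaU (a : D.Arc) :
    D.totalQuandleHom (D.gammaU a) = D.toConjMetabelian (PresentedQuandle.of a) :=
  (MulEquiv.symm_apply_eq _).2 (D.fox_of a).symm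

end VirtualLinkDiagram

end

theorem mainTheorem1 {μ : ℕ} (D : VirtualLinkDiagram μ) :
    ∃ e : D.TotalQuandle →◃ Quandle.Conj D.MetabelianQuotient,
      Function.Bijective e ∧ e '' D.fundamentalAlexanderQuandle = D.naturalImage := by
  refine ⟨D.totalQuandleHom, D.totalQuandleHom_bijective, ?_⟩
  rw [VirtualLinkDiagram.fundamentalAlexanderQuandle, QuandleClosure.image, ← Set.range_comp,
    VirtualLinkDiagram.naturalImage, PresentedQuandle.range_eq_closure]
  simp only [Function.comp_def, VirtualLinkDiagram.totalQuandleHom_gammaU]
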